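/- Let $(\Omega_1,\mathcal F_1,P_1)$ be a probability space, let $(\Omega,\mathcal F,P)$ be the product of countably infinitely many copies of it, indexed by $n=1,2,\dots$, and let $\Psi:\Omega_1\to\mathbb R$ be an arbitrary (possibly nonmeasurable) function. Put $X_n(\omega_1,\omega_2,\dots)=\Psi(\omega_n)$ and $S_n=X_1+\cdots+X_n$. For $f:\Omega\to\mathbb R$ let $f_*\le f\le f^*$ be its maximal measurable minorant and minimal measurable majorant with respect to $P$: $f_*$ and $f^*$ are measurable, with values in $[-\infty,\infty]$, and every measurable $g:\Omega\to[-\infty,\infty]$ with $g\le f$ everywhere satisfies $g\le f_*$ $P$-almost surely, while every measurable $h:\Omega\to[-\infty,\infty]$ with $h\ge f$ everywhere satisfies $h\ge f^*$ $P$-almost surely; these exist and are unique up to $P$-almost sure equality. Let $E_*[f]=E[f_*]$ and $E^*[f]=E[f^*]$ denote the lower and upper expectations. Call a set $H\subseteq\Omega$ maximally nonmeasurable if its inner measure $P_*(H)=\sup\{P(B):B\in\mathcal F,\ B\subseteq H\}$ is $0$ and its outer measure $P^*(H)=\inf\{P(B):B\in\mathcal F,\ B\supseteq H\}$ is $1$.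 Suppose that $E^*[|X_1|]<\infty$ and that $A$ is a non-empty proper subset of the interval $[E_*[X_1],E^*[X_1]]\subset\mathbb R$. Then each of the following subsets of $\Omega$ is maximally nonmeasurable: (i) the set where $\liminf_{n\to\infty} S_n/n\in A$; (ii) the set where $\limsup_{n\to\infty} S_n/n\in A$; (iii) the set where $\lim_{n\to\infty} S_n/n$ exists in $\mathbb R$ and lies in $A$; (iv) the set where $\lim_{n\to\infty} S_n/n$ exists in $\mathbb R$; (v) the set where all (real) limit points of the sequence $(S_n/n)_{n\ge 1}$ lie in $A$. -/

import Mathlib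

open MeasureTheory Filter Topology

/-- `g` is a maximal measurable minorant `f_*` of `f` on the measure space `(Ω, P)`. Extended real
values are needed, since a real function may have no real-valued measurable minorant at all. -/
def IsMaxMeasurableMinorant {Ω : Type*} [MeasurableSpace Ω] (P : Measure Ω)
    (f g : Ω → EReal) : Prop :=
  Measurable g ∧ (∀ ω, g ω ≤ f ω) ∧
    ∀ h : Ω → EReal, Measurable h → (∀ ω, h ω ≤ f ω) → ∀ᵐ ω ∂P, h ω ≤ g ω

/-- `g` is a minimal measurable majorant `f^*` of `f` on the measure space `(Ω, P)`. -/
def IsMinMeasurableMajorant {Ω : Type*} [MeasurableSpace Ω] (P : Measure Ω)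
    (f g : Ω → EReal) : Prop :=
  Measurable g ∧ (∀ ω, f ω ≤ g ω) ∧
    ∀ h : Ω → EReal, Measurable h → (∀ ω, f ω ≤ h ω) → ∀ᵐ ω ∂P, g ω ≤ h ω

theorem exists_isMinMeasurableMajorant {Ω : Type*} [MeasurableSpace Ω] (P : Measure Ω)
    [IsFiniteMeasure P] (f : Ω → EReal) : ∃ g, IsMinMeasurableMajorant P f g := by
  classical
  let T : ℚ → Set Ω := fun q => toMeasurable P {ω | ((q : ℝ) : EReal) < f ω}
  have hT : ∀ q, MeasurableSet (T q) := fun q => measurableSet_toMeasurable _ _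
  refine ⟨fun ω => ⨅ q : ℚ, if ω ∈ T q then ⊤ else ((q : ℝ) : EReal), ?_, ?_, ?_⟩
  · exact Measurable.iInf fun q => Measurable.ite (hT q) measurable_const measurable_const
  · intro ω
    refine le_iInf fun q => ?_
    split_ifs with h
    · exact le_top
    · by_contra hlt
      exact h (subset_toMeasurable P _ (not_le.1 hlt))
  · intro h hh hfh
    have key : ∀ q : ℚ, ∀ᵐ ω ∂P, ω ∈ T q → ((q : ℝ) : EReal) < h ω := by
      intro q
      have hm : MeasurableSet {ω | ((q : ℝ) : EReal) < h ω} := measurableSet_lt measurable_const hh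
      have e := Measure.measure_toMeasurable_inter (μ := P) hm.compl
        (measure_ne_top P {ω | ((q : ℝ) : EReal) < f ω})
      have e0 : {ω | ((q : ℝ) : EReal) < f ω} ∩ {ω | ((q : ℝ) : EReal) < h ω}ᶜ = ∅ := by
        ext ω
        simp only [Set.mem_inter_iff, Set.mem_ofPred_eq, Set.mem_compl_iff, Set.mem_empty_iff_false,
          iff_false, not_and, not_not]
        exact fun hq => hq.trans_le (hfh ω)
      rw [e0, measure_empty] at e
      rw [ae_iff]
      refine measure_mono_null ?_ e
      intro ω hω
      simpa using hω
    filter_upwards [ae_all_iff.2 key] with ω hω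
    refine le_of_forall_gt fun c hc => ?_
    obtain ⟨q, hq1, hq2⟩ := EReal.lt_iff_exists_rat_btwn.1 hc
    refine lt_of_le_of_lt (iInf_le _ q) ?_
    rw [if_neg fun hm => lt_asymm hq1 (hω q hm)]
    exact hq2

theorem exists_isMaxMeasurableMinorant {Ω : Type*} [MeasurableSpace Ω] (P : Measure Ω)
    [IsFiniteMeasure P] (f : Ω → EReal) : ∃ g, IsMaxMeasurableMinorant P f g := by
  obtain ⟨g, hg, hfg, hmin⟩ := exists_isMinMeasurableMajorant P (fun ω => - f ω)
  refine ⟨fun ω => - g ω, hg.neg, fun ω => EReal.neg_le.1 (hfg ω), fun h hh hhf => ?_⟩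
  filter_upwards [hmin (fun ω => - h ω) hh.neg fun ω => EReal.neg_le_neg_iff.2 (hhf ω)] with ω hω
  exact EReal.le_neg_of_le_neg hω

/-- The maximal measurable minorant `f_*` (unique up to almost sure equality). -/
noncomputable def maxMeasurableMinorant {Ω : Type*} [MeasurableSpace Ω] (P : Measure Ω)
    [IsFiniteMeasure P] (f : Ω → EReal) : Ω → EReal :=
  (exists_isMaxMeasurableMinorant P f).choose

/-- The minimal measurable majorant `f^*` (unique up to almost sure equality). -/
noncomputable def minMeasurableMajorant {Ω : Type*} [MeasurableSpace Ω] (P : Measure Ω)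
    [IsFiniteMeasure P] (f : Ω → EReal) : Ω → EReal :=
  (exists_isMinMeasurableMajorant P f).choose

/-- The expectation `E[g⁺] - E[g⁻]` of a measurable extended real function `g`; it is meaningful
unless both terms are infinite. -/
noncomputable def extExpectation {Ω : Type*} [MeasurableSpace Ω] (P : Measure Ω)
    (g : Ω → EReal) : EReal :=
  ((∫⁻ ω, (g ω).toENNReal ∂P : ENNReal) : EReal) - ((∫⁻ ω, (- g ω).toENNReal ∂P : ENNReal) : EReal)

/-- The lower expectation `E_*[f] = E[f_*]` of a possibly nonmeasurable real function. -/
noncomputable def lowerExpectation {Ω : Type*} [MeasurableSpace Ω] (P : Measure Ω)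
    [IsFiniteMeasure P] (f : Ω → ℝ) : EReal :=
  extExpectation P (maxMeasurableMinorant P fun ω => (f ω : EReal))

/-- The upper expectation `E^*[f] = E[f^*]` of a possibly nonmeasurable real function. -/
noncomputable def upperExpectation {Ω : Type*} [MeasurableSpace Ω] (P : Measure Ω)
    [IsFiniteMeasure P] (f : Ω → ℝ) : EReal :=
  extExpectation P (minMeasurableMajorant P fun ω => (f ω : EReal))

/-- The inner measure: the supremum of the measures of the measurable subsets. -/
noncomputable def innerMeasure {Ω : Type*} [MeasurableSpace Ω] (P : Measure Ω) (H : Set Ω) :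
    ENNReal :=
  ⨆ (B : Set Ω) (_ : MeasurableSet B) (_ : B ⊆ H), P B

/-- The outer measure: the infimum of the measures of the measurable supersets. -/
noncomputable def outerMeasure {Ω : Type*} [MeasurableSpace Ω] (P : Measure Ω) (H : Set Ω) :
    ENNReal :=
  ⨅ (B : Set Ω) (_ : MeasurableSet B) (_ : H ⊆ B), P B

/-- Inner measure zero and outer measure one. -/
def MaximallyNonmeasurable {Ω : Type*} [MeasurableSpace Ω] (P : Measure Ω) (H : Set Ω) : Prop :=
  innerMeasure P H = 0 ∧ outerMeasure P H = 1

/-- The sequence `X_n(ω) = Ψ(ω_n)` on the infinite product; `Ψ` need not be measurable. The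
indices start at `0`, so that the first variable is `iidVar Ψ 0`. -/
def iidVar {Ω₁ : Type*} (Ψ : Ω₁ → ℝ) (n : ℕ) (ω : ℕ → Ω₁) : ℝ := Ψ (ω n)

/-- The mean `S_n / n` of the first `n` variables. -/
noncomputable def iidMean {Ω₁ : Type*} (Ψ : Ω₁ → ℝ) (ω : ℕ → Ω₁) (n : ℕ) : ℝ :=
  (∑ i ∈ Finset.range n, iidVar Ψ i ω) / (n : ℝ)

/-! The outer measure of an arbitrary set `H` is Mathlib's `P H`, so "outer measure one" reads
`P H = 1`, and `H` is maximally nonmeasurable as soon as both `H` and a set disjoint from `H` have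
outer measure one (`maximallyNonmeasurable_of_superset`).

Let `l ≤ Ψ ≤ u` be the maximal measurable minorant and minimal measurable majorant of `Ψ`; the
moment assumption makes them integrable. For every `ε > 0` the sets `{|Ψ - l| < ε}` and
`{|Ψ - u| < ε}` have outer measure one, since otherwise `u` could be lowered by `ε` on a set of
positive measure (`exists_integrable_majorant`). A countable product of sets of outer measure one
has outer measure one in the product space (`infinitePi_univ_pi_eq_one`). Therefore, on a set of
outer measure one, the `n`-th variable is within `1 / (n + 1)` of `u` or of `l`, whichever is
prescribed, and the averages `S_n / n` behave like averages of independent *measurable* variables.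

* Choosing between `u` and `l` by independent coin tosses gives i.i.d. variables with any mean `c`
  in `[E l, E u] = [E_* X_1, E^* X_1]`, and the strong law of large numbers shows that
  `S_n / n → c` holds on a set of outer measure one (`measure_tendsto_iidMean_eq_one`).
* Choosing `u` and `l` alternately on the blocks `[4 ^ j, 4 ^ (j + 1))` makes `S_n / n` diverge on a
  set of outer measure one when `E l < E u` (`measure_not_tendsto_iidMean_eq_one`).

With `a ∈ A` and `b ∈ [E_* X_1, E^* X_1] \ A`, each of the five sets contains `{S_n / n → a}`. The
divergence set is disjoint from the set of convergence, and `{S_n / n → b}` is disjoint from the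
other four. -/

/-! ### Sets of outer measure one -/

theorem measure_eq_one_of_disjoint_null {Ω : Type*} [MeasurableSpace Ω] {P : Measure Ω}
    [IsProbabilityMeasure P] {E : Set Ω}
    (h : ∀ C, MeasurableSet C → Disjoint C E → P C = 0) : P E = 1 := by
  rw [← measure_toMeasurable]
  exact (prob_compl_eq_zero_iff (measurableSet_toMeasurable P E)).1
    (h _ (measurableSet_toMeasurable P E).compl
      (Set.disjoint_compl_left_iff_subset.2 (subset_toMeasurable P E)))

theorem measure_eq_zero_of_disjoint {Ω : Type*} [MeasurableSpace Ω] {P : Measure Ω}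
    [IsProbabilityMeasure P] {E C : Set Ω} (hE : P E = 1) (hC : MeasurableSet C)
    (h : Disjoint C E) : P C = 0 := by
  rw [← prob_compl_eq_one_iff hC]
  exact le_antisymm prob_le_one (hE ▸ measure_mono (Set.disjoint_left.1 h.symm))

/-- A probability measure has a trace on every set `E` of outer measure one, measurable or not: the
set function `E ∩ C ↦ μ (E ∩ C)`, whose image under the inclusion is `μ` again. -/
theorem exists_trace_measure {M : Type*} [MeasurableSpace M] (μ : Measure M)
    [IsProbabilityMeasure μ] {E : Set M} (hE : μ E = 1) :
    ∃ ν : Measure E, IsProbabilityMeasure ν ∧ ν.map (Subtype.val : E → M) = μ := by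
  -- `Measure.comap` is `0` when `E` is not null measurable, so the trace is built from the outer
  -- measure induced on `E`.
  let o : OuterMeasure E := OuterMeasure.comap (Subtype.val : E → M) μ.toOuterMeasure
  have ho : (inferInstance : MeasurableSpace E) ≤ o.caratheodory := by
    rintro _ ⟨C, hC, rfl⟩
    refine (OuterMeasure.isCaratheodory_iff _).2 fun t => ?_
    change μ (Subtype.val '' t) = μ (Subtype.val '' (t ∩ Subtype.val ⁻¹' C)) +
      μ (Subtype.val '' (t \ Subtype.val ⁻¹' C))
    rw [Set.image_inter_preimage, Set.sdiff_eq, ← Set.preimage_compl,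
      Set.image_inter_preimage, ← Set.sdiff_eq, measure_inter_add_sdiff _ hC]
  have hmap : (o.toMeasure ho).map (Subtype.val : E → M) = μ := by
    ext C hC
    rw [Measure.map_apply measurable_subtype_coe hC,
      toMeasure_apply _ _ (measurable_subtype_coe hC)]
    change μ (Subtype.val '' (Subtype.val ⁻¹' C)) = μ C
    rw [Subtype.image_preimage_coe]
    refine le_antisymm (measure_mono Set.inter_subset_right) ?_
    have h1 := measure_inter_add_sdiff (μ := μ) E hC
    have h2 := measure_add_measure_compl (μ := μ) hC
    have h3 : μ (E \ C) ≤ μ Cᶜ := measure_mono fun x hx => hx.2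
    rw [hE] at h1
    rw [measure_univ, ← h1] at h2
    refine (ENNReal.add_le_add_iff_right (measure_ne_top μ Cᶜ)).1 ?_
    rw [h2]
    gcongr
  refine ⟨o.toMeasure ho, ⟨?_⟩, hmap⟩
  rw [← measure_univ (μ := μ), ← hmap, Measure.map_apply measurable_subtype_coe .univ,
    Set.preimage_univ]

/-- The product measure is the image of the product of the traces on the `E n`, which lives on the
product of the `E n`; hence a measurable set disjoint from that product is null. -/
theorem infinitePi_univ_pi_eq_one {M : Type*} [MeasurableSpace M] (μ : Measure M)
    [IsProbabilityMeasure μ] {E : ℕ → Set M} (hE : ∀ n, μ (E n) = 1) :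
    Measure.infinitePi (fun _ : ℕ => μ) (Set.univ.pi E) = 1 := by
  choose ν hν hmap using fun n => exists_trace_measure μ (hE n)
  refine measure_eq_one_of_disjoint_null fun C hC hd => ?_
  have key := Measure.infinitePi_map_pi (μ := ν) (f := fun n => (Subtype.val : E n → M))
    (fun n => measurable_subtype_coe)
  simp only [hmap] at key
  rw [← key, Measure.map_apply (by fun_prop) hC]
  convert measure_empty (μ := Measure.infinitePi ν)
  refine Set.eq_empty_of_forall_notMem fun x hx => Set.disjoint_left.1 hd hx fun n _ => (x n).2

theorem maximallyNonmeasurable_of_superset {Ω : Type*} [MeasurableSpace Ω] {P : Measure Ω}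
    [IsProbabilityMeasure P] {H K K' : Set Ω} (hK : P K = 1) (hKH : K ⊆ H) (hK' : P K' = 1)
    (hd : Disjoint K' H) : MaximallyNonmeasurable P H := by
  constructor
  · simp only [innerMeasure, ENNReal.iSup_eq_zero]
    exact fun B hB hBH => measure_eq_zero_of_disjoint hK' hB (hd.symm.mono_left hBH)
  · refine le_antisymm ?_ ?_
    · exact iInf_le_of_le Set.univ (iInf₂_le_of_le .univ (Set.subset_univ _) prob_le_one)
    · exact le_iInf fun B => le_iInf₂ fun _ hB => hK ▸ measure_mono (hKH.trans hB)

/-! ### Laws of large numbers -/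

theorem integral_eval_infinitePi {M : Type*} [MeasurableSpace M] (μ : Measure M)
    [IsProbabilityMeasure μ] {Y : M → ℝ} (hm : Measurable Y) (i : ℕ) :
    ∫ m, Y (m i) ∂Measure.infinitePi (fun _ : ℕ => μ) = ∫ x, Y x ∂μ := by
  conv_rhs => rw [← (measurePreserving_eval_infinitePi (fun _ : ℕ => μ) i).map_eq]
  exact (integral_map (measurable_pi_apply i).aemeasurable hm.aestronglyMeasurable).symm

theorem ae_tendsto_mean_infinitePi {M : Type*} [MeasurableSpace M] (μ : Measure M)
    [IsProbabilityMeasure μ] {Y : M → ℝ} (hm : Measurable Y) (hi : Integrable Y μ) :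
    ∀ᵐ m ∂Measure.infinitePi (fun _ : ℕ => μ),
      Tendsto (fun n : ℕ => (∑ i ∈ Finset.range n, Y (m i)) / n) atTop (𝓝 (∫ x, Y x ∂μ)) := by
  have hp (n : ℕ) := measurePreserving_eval_infinitePi (fun _ : ℕ => μ) n
  have hind := ProbabilityTheory.iIndepFun_infinitePi (P := fun _ : ℕ => μ) (X := fun _ => Y)
    (fun _ => hm)
  have hY (i : ℕ) : Measurable fun m : ℕ → M => Y (m i) := hm.comp (measurable_pi_apply i)
  have hlaw (i : ℕ) : (Measure.infinitePi fun _ : ℕ => μ).map (fun m => Y (m i)) = μ.map Y := by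
    rw [← Function.comp_def Y, ← Measure.map_map hm (measurable_pi_apply i)]
    exact congrArg _ (hp i).map_eq
  have hindep : Pairwise fun i j => ProbabilityTheory.IndepFun (fun m : ℕ → M => Y (m i))
      (fun m => Y (m j)) (Measure.infinitePi fun _ : ℕ => μ) := fun i j hij => hind.indepFun hij
  have hident (i : ℕ) : ProbabilityTheory.IdentDistrib (fun m : ℕ → M => Y (m i))
      (fun m => Y (m 0)) (Measure.infinitePi fun _ : ℕ => μ) (Measure.infinitePi fun _ : ℕ => μ) :=
    ⟨(hY i).aemeasurable, (hY 0).aemeasurable, (hlaw i).trans (hlaw 0).symm⟩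
  have hint0 : Integrable (fun m : ℕ → M => Y (m 0)) (Measure.infinitePi fun _ : ℕ => μ) :=
    (hp 0).integrable_comp_of_integrable hi
  have key := ProbabilityTheory.strong_law_ae_real (fun (i : ℕ) (m : ℕ → M) => Y (m i))
    hint0 hindep hident
  rw [integral_eval_infinitePi μ hm 0] at key
  exact key

/-! ### Prescribing the behaviour of the averages -/

/-- The sequence `Ψ (ω n)` may be replaced by measurable variables `Y n` at arbitrarily small
distance from it on sets of outer measure one, possibly after passing to an extension `M` of `Ω₁`
that provides auxiliary randomness: what holds almost surely when `Ψ (ω n) - Y n → 0` holds on a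
set of outer measure one. -/
theorem measure_infinitePi_eq_one_of_coupling {Ω₁ M : Type*} [MeasurableSpace Ω₁]
    [MeasurableSpace M] {P₁ : Measure Ω₁} [IsProbabilityMeasure P₁] {μ : Measure M}
    [IsProbabilityMeasure μ] {π : M → Ω₁} (hπ : MeasurePreserving π μ P₁) {Ψ : Ω₁ → ℝ}
    {Y : ℕ → M → ℝ} (hY : ∀ n, ∀ ε > 0, μ {m | |Ψ (π m) - Y n m| < ε} = 1)
    {H : Set (ℕ → Ω₁)}
    (hH : ∀ᵐ m ∂Measure.infinitePi (fun _ : ℕ => μ),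
      Tendsto (fun n => Ψ (π (m n)) - Y n (m n)) atTop (𝓝 0) → (fun n => π (m n)) ∈ H) :
    Measure.infinitePi (fun _ : ℕ => P₁) H = 1 := by
  obtain ⟨N, hN, hNm, hN0⟩ := exists_measurable_superset_of_null (ae_iff.1 hH)
  refine measure_eq_one_of_disjoint_null fun C hC hd => ?_
  have key := Measure.infinitePi_map_pi (μ := fun _ : ℕ => μ) (f := fun _ : ℕ => π)
    (fun _ => hπ.measurable)
  simp only [hπ.map_eq] at key
  have hm : Measurable fun (m : ℕ → M) n => π (m n) :=
    measurable_pi_lambda _ fun n => hπ.measurable.comp (measurable_pi_apply n)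
  rw [← key, Measure.map_apply hm hC, ← measure_sdiff_null hN0]
  refine measure_eq_zero_of_disjoint
    (infinitePi_univ_pi_eq_one μ fun n => hY n (1 / ((n : ℝ) + 1)) (by positivity))
    ((hm hC).diff hNm) (Set.disjoint_left.2 ?_)
  rintro m ⟨hmC, hmN⟩ hmE
  refine hmN (hN fun h => Set.disjoint_left.1 hd hmC (h ?_))
  exact squeeze_zero_norm (fun n => (hmE n trivial).le) tendsto_one_div_add_atTop_nhds_zero_nat

theorem tendsto_mean_sub_of_tendsto_sub {x y : ℕ → ℝ}
    (h : Tendsto (fun n => x n - y n) atTop (𝓝 0)) :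
    Tendsto (fun n : ℕ => (∑ i ∈ Finset.range n, x i) / n - (∑ i ∈ Finset.range n, y i) / n)
      atTop (𝓝 0) := by
  refine h.cesaro.congr fun n => ?_
  rw [Finset.sum_sub_distrib]
  ring

/-- The measure on `Ω₁ × Bool` makes the coin independent of the point of `Ω₁` and chooses `u` with
the probability `q` for which `(1 - q) E l + q E u = c`. -/
theorem measure_tendsto_iidMean_eq_one {Ω₁ : Type*} [MeasurableSpace Ω₁] {P₁ : Measure Ω₁}
    [IsProbabilityMeasure P₁] {Ψ l u : Ω₁ → ℝ} (hlm : Measurable l) (hum : Measurable u)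
    (hli : Integrable l P₁) (hui : Integrable u P₁)
    (hl : ∀ ε > 0, P₁ {ω | |Ψ ω - l ω| < ε} = 1) (hu : ∀ ε > 0, P₁ {ω | |Ψ ω - u ω| < ε} = 1)
    {c : ℝ} (hc : c ∈ Set.Icc (∫ ω, l ω ∂P₁) (∫ ω, u ω ∂P₁)) :
    Measure.infinitePi (fun _ : ℕ => P₁) {ω | Tendsto (iidMean Ψ ω) atTop (𝓝 c)} = 1 := by
  rw [← segment_eq_Icc (hc.1.trans hc.2)] at hc
  obtain ⟨p, q, hp, hq, hpq, rfl⟩ := hc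
  have hpq' : ENNReal.ofReal p + ENNReal.ofReal q = 1 := by
    rw [← ENNReal.ofReal_add hp hq, hpq, ENNReal.ofReal_one]
  have hs (t : Bool) : Measurable fun ω : Ω₁ => (ω, t) := by fun_prop
  let μ : Measure (Ω₁ × Bool) :=
    ENNReal.ofReal p • P₁.map (fun ω => (ω, false)) +
      ENNReal.ofReal q • P₁.map (fun ω => (ω, true))
  have hμ (C : Set (Ω₁ × Bool)) (hC : MeasurableSet C) : μ C =
      ENNReal.ofReal p * P₁ ((fun ω => (ω, false)) ⁻¹' C) +
        ENNReal.ofReal q * P₁ ((fun ω => (ω, true)) ⁻¹' C) := by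
    simp only [μ, Measure.add_apply, Measure.smul_apply, smul_eq_mul]
    rw [Measure.map_apply (hs _) hC, Measure.map_apply (hs _) hC]
  have : IsProbabilityMeasure μ := ⟨by simp [hμ _ .univ, hpq']⟩
  have hπ : MeasurePreserving Prod.fst μ P₁ := by
    refine ⟨measurable_fst, Measure.ext fun C hC => ?_⟩
    rw [Measure.map_apply measurable_fst hC, hμ _ (measurable_fst hC)]
    simp only [← Set.preimage_comp, Function.comp_def, Set.preimage_id']
    rw [← add_mul, hpq', one_mul]
  let Y : Ω₁ × Bool → ℝ := fun m => if m.2 = true then u m.1 else l m.1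
  have hYm : Measurable Y := Measurable.ite (measurable_snd (measurableSet_singleton true))
    (hum.comp measurable_fst) (hlm.comp measurable_fst)
  have hYl : Integrable Y (P₁.map fun ω => (ω, false)) :=
    (integrable_map_measure hYm.aestronglyMeasurable (hs _).aemeasurable).2 (by
      simpa [Y, Function.comp_def] using hli)
  have hYu : Integrable Y (P₁.map fun ω => (ω, true)) :=
    (integrable_map_measure hYm.aestronglyMeasurable (hs _).aemeasurable).2 (by
      simpa [Y, Function.comp_def] using hui)
  have hYl' := hYl.smul_measure (ENNReal.ofReal_ne_top (r := p))
  have hYu' := hYu.smul_measure (ENNReal.ofReal_ne_top (r := q))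
  have hYint : ∫ m, Y m ∂μ = p • (∫ ω, l ω ∂P₁) + q • (∫ ω, u ω ∂P₁) := by
    rw [integral_add_measure hYl' hYu', integral_smul_measure, integral_smul_measure,
      integral_map (hs _).aemeasurable hYm.aestronglyMeasurable,
      integral_map (hs _).aemeasurable hYm.aestronglyMeasurable,
      ENNReal.toReal_ofReal hp, ENNReal.toReal_ofReal hq]
    simp [Y]
  refine measure_infinitePi_eq_one_of_coupling hπ (Ψ := Ψ) (Y := fun _ => Y)
    (fun _ ε hε => measure_eq_one_of_disjoint_null fun C hC hd => ?_) ?_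
  · have h0 := measure_eq_zero_of_disjoint (hl ε hε) (hs false hC) (Set.disjoint_left.2
      fun ω h1 h2 => Set.disjoint_left.1 hd h1 (by simpa [Y] using h2))
    have h1 := measure_eq_zero_of_disjoint (hu ε hε) (hs true hC) (Set.disjoint_left.2
      fun ω h1 h2 => Set.disjoint_left.1 hd h1 (by simpa [Y] using h2))
    rw [hμ C hC, h0, h1, mul_zero, mul_zero, add_zero]
  · rw [← hYint]
    filter_upwards [ae_tendsto_mean_infinitePi μ hYm (hYl'.add_measure hYu')] with m hm hclose
    have := (tendsto_mean_sub_of_tendsto_sub hclose).add hm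
    simp only [sub_add_cancel, zero_add] at this
    exact this

/-- The averages of a sequence over the blocks `[4 ^ j, 4 ^ (j + 1))` are determined by the limit of
its running averages, so two sequences that agree on infinitely many blocks have the same limit. -/
theorem eq_of_tendsto_mean_of_eq_on_blocks {x y : ℕ → ℝ} {L d : ℝ} {e : ℕ → ℕ}
    (he : Tendsto e atTop atTop)
    (hx : Tendsto (fun n : ℕ => (∑ i ∈ Finset.range n, x i) / n) atTop (𝓝 L))
    (hy : Tendsto (fun n : ℕ => (∑ i ∈ Finset.range n, y i) / n) atTop (𝓝 d))
    (hxy : ∀ k, ∀ i ∈ Finset.Ico (4 ^ e k) (4 ^ (e k + 1)), x i = y i) : L = d := by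
  have h4 : Tendsto (fun k => 4 ^ e k) atTop atTop :=
    (tendsto_pow_atTop_atTop_of_one_lt (by norm_num : 1 < 4)).comp he
  have h4' : Tendsto (fun k => 4 ^ (e k + 1)) atTop atTop :=
    (tendsto_pow_atTop_atTop_of_one_lt (by norm_num : 1 < 4)).comp
      ((tendsto_add_atTop_nat 1).comp he)
  have hX := (hx.comp h4').sub ((hx.comp h4).div_const 4)
  have hY := (hy.comp h4').sub ((hy.comp h4).div_const 4)
  have key (z : ℕ → ℝ) (k : ℕ) : (∑ i ∈ Finset.range (4 ^ (e k + 1)), z i) /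
      ((4 ^ (e k + 1) : ℕ) : ℝ) - (∑ i ∈ Finset.range (4 ^ e k), z i) / ((4 ^ e k : ℕ) : ℝ) / 4 =
      (∑ i ∈ Finset.Ico (4 ^ e k) (4 ^ (e k + 1)), z i) / ((4 ^ (e k + 1) : ℕ) : ℝ) := by
    rw [Finset.sum_Ico_eq_sub _ (Nat.pow_le_pow_right (by norm_num) (Nat.le_succ _))]
    rw [sub_div, div_div]
    congr 2
    push_cast
    ring
  have hXY : L - L / 4 = d - d / 4 := by
    refine tendsto_nhds_unique hX (hY.congr fun k => ?_)
    simp only [Function.comp_apply]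
    rw [key, key, Finset.sum_congr rfl (hxy k)]
  linarith

theorem measure_not_tendsto_iidMean_eq_one {Ω₁ : Type*} [MeasurableSpace Ω₁] {P₁ : Measure Ω₁}
    [IsProbabilityMeasure P₁] {Ψ l u : Ω₁ → ℝ} (hlm : Measurable l) (hum : Measurable u)
    (hli : Integrable l P₁) (hui : Integrable u P₁)
    (hl : ∀ ε > 0, P₁ {ω | |Ψ ω - l ω| < ε} = 1) (hu : ∀ ε > 0, P₁ {ω | |Ψ ω - u ω| < ε} = 1)
    (hne : ∫ ω, l ω ∂P₁ ≠ ∫ ω, u ω ∂P₁) :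
    Measure.infinitePi (fun _ : ℕ => P₁) {ω | ¬ ∃ c : ℝ, Tendsto (iidMean Ψ ω) atTop (𝓝 c)} = 1 := by
  refine measure_infinitePi_eq_one_of_coupling (MeasurePreserving.id P₁) (Ψ := Ψ)
    (Y := fun n => if Even (Nat.log 4 n) then u else l) (fun n ε hε => ?_) ?_
  · split_ifs
    exacts [hu ε hε, hl ε hε]
  · filter_upwards [ae_tendsto_mean_infinitePi P₁ hlm hli, ae_tendsto_mean_infinitePi P₁ hum hui]
      with ω hlω huω hclose
    rintro ⟨c, hc⟩
    have hY := hc.sub (tendsto_mean_sub_of_tendsto_sub hclose)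
    simp only [iidMean, iidVar, id, sub_sub_cancel, sub_zero] at hY
    have hlog {j i : ℕ} (hi : i ∈ Finset.Ico (4 ^ j) (4 ^ (j + 1))) : Nat.log 4 i = j :=
      Nat.log_eq_of_pow_le_of_lt_pow (Finset.mem_Ico.1 hi).1 (Finset.mem_Ico.1 hi).2
    refine hne (Eq.trans (b := c) (Eq.symm ?_) ?_)
    · refine eq_of_tendsto_mean_of_eq_on_blocks (e := fun k => 2 * k + 1)
        (tendsto_atTop_mono (fun k => by simp only [id]; omega) tendsto_id) hY hlω fun k i hi => ?_
      rw [hlog hi, if_neg (by simp)]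
    · refine eq_of_tendsto_mean_of_eq_on_blocks (e := fun k => 2 * k)
        (tendsto_atTop_mono (fun k => by simp only [id]; omega) tendsto_id) hY huω fun k i hi => ?_
      rw [hlog hi, if_pos (by simp)]

/-! ### Measurable majorants and expectations -/

theorem IsMinMeasurableMajorant.ae_eq {Ω : Type*} [MeasurableSpace Ω] {P : Measure Ω}
    {f g h : Ω → EReal} (hg : IsMinMeasurableMajorant P f g) (hh : IsMinMeasurableMajorant P f h) :
    g =ᵐ[P] h := by
  filter_upwards [hg.2.2 h hh.1 hh.2.1, hh.2.2 g hg.1 hg.2.1] with ω h1 h2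
  exact le_antisymm h1 h2

theorem IsMaxMeasurableMinorant.neg {Ω : Type*} [MeasurableSpace Ω] {P : Measure Ω}
    {f g : Ω → EReal} (hg : IsMaxMeasurableMinorant P f g) :
    IsMinMeasurableMajorant P (fun ω => -f ω) (fun ω => -g ω) := by
  refine ⟨hg.1.neg, fun ω => EReal.neg_le_neg_iff.2 (hg.2.1 ω), fun h hh hfh => ?_⟩
  filter_upwards [hg.2.2 (fun ω => -h ω) hh.neg fun ω => EReal.neg_le.1 (hfh ω)] with ω hω
  exact EReal.neg_le.1 hω

/-- A minimal majorant of `f` on `Ω₁` remains minimal among the majorants of `f (ω 0)` on the product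
space, although these may depend on all coordinates. For each `q`, the set where `f > q` or `U ≤ q`
has outer measure one, and the majorant `h` cannot satisfy `h ω ≤ q < U (ω 0)` when `ω 0` is in
it. -/
theorem IsMinMeasurableMajorant.comp_eval_zero {Ω₁ : Type*} [MeasurableSpace Ω₁] {P₁ : Measure Ω₁}
    [IsProbabilityMeasure P₁] {f U : Ω₁ → EReal} (hU : IsMinMeasurableMajorant P₁ f U) :
    IsMinMeasurableMajorant (Measure.infinitePi fun _ : ℕ => P₁)
      (fun ω => f (ω 0)) (fun ω => U (ω 0)) := by
  classical
  obtain ⟨hUm, hfU, hmin⟩ := hU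
  refine ⟨hUm.comp (measurable_pi_apply 0), fun ω => hfU _, fun h hh hfh => ?_⟩
  have hE (q : ℚ) : P₁ {x | ((q : ℝ) : EReal) < f x ∨ U x ≤ ((q : ℝ) : EReal)} = 1 := by
    refine measure_eq_one_of_disjoint_null fun C hC hd => ?_
    have hC' {x} (hx : x ∈ C) : f x ≤ ((q : ℝ) : EReal) ∧ ((q : ℝ) : EReal) < U x := by
      simpa using Set.disjoint_left.1 hd hx
    -- On `C` one has `f ≤ q < U`, so lowering `U` to `q` there gives another majorant.
    have := hmin (fun x => if x ∈ C then ((q : ℝ) : EReal) else U x)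
      (Measurable.ite hC measurable_const hUm) fun x => by
        split_ifs with hx
        exacts [(hC' hx).1, hfU x]
    refine measure_mono_null (fun x hx => ?_) (ae_iff.1 this)
    simpa [hx] using (hC' hx).2
  have key (q : ℚ) : ∀ᵐ ω ∂Measure.infinitePi fun _ : ℕ => P₁,
      ¬ (h ω ≤ ((q : ℝ) : EReal) ∧ ((q : ℝ) : EReal) < U (ω 0)) := by
    rw [ae_iff]
    simp only [not_not]
    refine measure_eq_zero_of_disjoint (infinitePi_univ_pi_eq_one P₁ fun _ => hE q)
      ((measurableSet_le hh measurable_const).inter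
        (measurableSet_lt measurable_const (hUm.comp (measurable_pi_apply 0)))) ?_
    refine Set.disjoint_left.2 fun ω h1 h2 => ?_
    rcases h2 0 trivial with h3 | h3
    · exact absurd ((hfh ω).trans h1.1) (not_le.2 h3)
    · exact absurd h1.2 (not_lt.2 h3)
  filter_upwards [ae_all_iff.2 key] with ω hω
  by_contra! hlt
  obtain ⟨q, hq1, hq2⟩ := EReal.lt_iff_exists_rat_btwn.1 hlt
  exact hω q ⟨hq1.le, hq2⟩

theorem extExpectation_eq_integral {Ω : Type*} [MeasurableSpace Ω] {P : Measure Ω}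
    {g : Ω → EReal} {v : Ω → ℝ} (hg : g =ᵐ[P] fun ω => (v ω : EReal)) (hv : Integrable v P) :
    extExpectation P g = ((∫ ω, v ω ∂P : ℝ) : EReal) := by
  have h1 : ∫⁻ ω, (g ω).toENNReal ∂P = ∫⁻ ω, ENNReal.ofReal (v ω) ∂P :=
    lintegral_congr_ae (hg.mono fun ω hω => by simp only [hω, EReal.real_coe_toENNReal])
  have h2 : ∫⁻ ω, (-g ω).toENNReal ∂P = ∫⁻ ω, ENNReal.ofReal (-v ω) ∂P :=
    lintegral_congr_ae (hg.mono fun ω hω => by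
      simp only [hω, ← EReal.coe_neg, EReal.real_coe_toENNReal])
  have h3 : ∫⁻ ω, ENNReal.ofReal (v ω) ∂P ≠ ⊤ := hv.lintegral_lt_top.ne
  have h4 : ∫⁻ ω, ENNReal.ofReal (-v ω) ∂P ≠ ⊤ := hv.neg.lintegral_lt_top.ne
  rw [extExpectation, h1, h2, integral_eq_lintegral_pos_part_sub_lintegral_neg_part hv,
    EReal.coe_sub, EReal.coe_ennreal_toReal h3, EReal.coe_ennreal_toReal h4]

theorem lintegral_minMeasurableMajorant_abs_ne_top {Ω₁ : Type*} [MeasurableSpace Ω₁]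
    {P₁ : Measure Ω₁} [IsProbabilityMeasure P₁] {Ψ : Ω₁ → ℝ} {V : Ω₁ → EReal}
    (hV : IsMinMeasurableMajorant P₁ (fun x => ((|Ψ x| : ℝ) : EReal)) V)
    (hΨ : upperExpectation (Measure.infinitePi fun _ : ℕ => P₁) (fun ω => |Ψ (ω 0)|) < ⊤) :
    ∫⁻ x, (V x).toENNReal ∂P₁ ≠ ⊤ := by
  have hG := (exists_isMinMeasurableMajorant (Measure.infinitePi fun _ : ℕ => P₁)
    (fun ω => ((|Ψ (ω 0)| : ℝ) : EReal))).choose_spec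
  have hae := hV.comp_eval_zero.ae_eq hG
  have hneg (ω : ℕ → Ω₁) : (-(minMeasurableMajorant (Measure.infinitePi fun _ : ℕ => P₁)
      (fun ω => ((|Ψ (ω 0)| : ℝ) : EReal)) ω)).toENNReal = 0 := by
    refine EReal.toENNReal_of_nonpos (EReal.neg_le.1 ?_)
    rw [neg_zero]
    exact (EReal.coe_nonneg.2 (abs_nonneg _)).trans (hG.2.1 ω)
  rw [upperExpectation, extExpectation] at hΨ
  simp only [hneg, lintegral_zero, EReal.coe_ennreal_zero, sub_zero] at hΨ
  have hfin : ∫⁻ ω, (V (ω 0)).toENNReal ∂Measure.infinitePi (fun _ : ℕ => P₁) ≠ ⊤ := by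
    rw [lintegral_congr_ae (hae.mono fun ω hω => congrArg EReal.toENNReal hω)]
    intro h
    exact hΨ.ne (by rw [← EReal.coe_ennreal_top, ← h]; rfl)
  rwa [← (measurePreserving_eval_infinitePi (fun _ : ℕ => P₁) 0).lintegral_comp
    hV.1.ereal_toENNReal]

/-- A real-valued version `u` of the minimal measurable majorant of `Ψ`. It is integrable since
`-|Ψ|^* ≤ Ψ ≤ Ψ^* ≤ |Ψ|^*` and `E |Ψ|^* < ∞`, and it is approached by `Ψ` on sets of outer measure
one. The pointwise bound `Ψ ≤ u` may fail on the null set where the extended real majorant is `⊤`.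
-/
theorem exists_integrable_majorant {Ω₁ : Type*} [MeasurableSpace Ω₁]
    {P₁ : Measure Ω₁} [IsProbabilityMeasure P₁] {Ψ : Ω₁ → ℝ}
    (hΨ : upperExpectation (Measure.infinitePi fun _ : ℕ => P₁) (fun ω => |Ψ (ω 0)|) < ⊤) :
    ∃ u : Ω₁ → ℝ, Measurable u ∧ Integrable u P₁ ∧ (∀ ε > 0, P₁ {x | |Ψ x - u x| < ε} = 1) ∧
      ∀ g, IsMinMeasurableMajorant (Measure.infinitePi fun _ : ℕ => P₁)
        (fun ω => (Ψ (ω 0) : EReal)) g →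
        g =ᵐ[Measure.infinitePi fun _ : ℕ => P₁] fun ω => (u (ω 0) : EReal) := by
  classical
  obtain ⟨V, hV⟩ := exists_isMinMeasurableMajorant P₁ (fun x => ((|Ψ x| : ℝ) : EReal))
  obtain ⟨U, hU⟩ := exists_isMinMeasurableMajorant P₁ (fun x => (Ψ x : EReal))
  have hVfin := lintegral_minMeasurableMajorant_abs_ne_top hV hΨ
  have hUV : ∀ᵐ x ∂P₁, U x ≤ V x := hU.2.2 V hV.1 fun x =>
    (EReal.coe_le_coe_iff.2 (le_abs_self _)).trans (hV.2.1 x)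
  have hVU (x : Ω₁) : -V x ≤ U x := EReal.neg_le.1 <| by
    refine le_trans ?_ (hV.2.1 x)
    refine (EReal.neg_le_neg_iff.2 (hU.2.1 x)).trans ?_
    rw [← EReal.coe_neg]
    exact EReal.coe_le_coe_iff.2 (neg_le_abs _)
  have hVtop : ∀ᵐ x ∂P₁, V x ≠ ⊤ := by
    filter_upwards [ae_lt_top hV.1.ereal_toENNReal hVfin] with x hx
    exact EReal.toENNReal_ne_top_iff.1 hx.ne
  have hUbot (x : Ω₁) : U x ≠ ⊥ := fun h => by simpa [h] using hU.2.1 x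
  have hUtop : ∀ᵐ x ∂P₁, U x ≠ ⊤ := by
    filter_upwards [hUV, hVtop] with x h1 h2 h3
    exact h2 (top_le_iff.1 (h3 ▸ h1))
  have hUu : ∀ᵐ x ∂P₁, U x = ((U x).toReal : EReal) := by
    filter_upwards [hUtop] with x hx
    exact (EReal.coe_toReal hx (hUbot x)).symm
  have hum : Measurable fun x => (U x).toReal := hU.1.ereal_toReal
  refine ⟨fun x => (U x).toReal, hum, ?_, fun ε hε => ?_, fun g hg => ?_⟩
  · refine Integrable.mono' (integrable_toReal_of_lintegral_ne_top
      hV.1.ereal_toENNReal.aemeasurable hVfin) hum.aestronglyMeasurable ?_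
    filter_upwards [hUV, hVtop, hUu] with x h1 h2 h3
    have hV0 : 0 ≤ V x := (EReal.coe_nonneg.2 (abs_nonneg _)).trans (hV.2.1 x)
    have h4 := hVU x
    rw [EReal.toReal_toENNReal hV0]
    rw [← EReal.coe_toReal h2 (fun h => by simp [h] at hV0), h3] at h1 h4
    rw [← EReal.coe_neg] at h4
    exact abs_le.2 ⟨EReal.coe_le_coe_iff.1 h4, EReal.coe_le_coe_iff.1 h1⟩
  · refine measure_eq_one_of_disjoint_null fun C hC hd => ?_
    have hC' {x} (hx : x ∈ C) (hx' : U x ≠ ⊤) : Ψ x ≤ (U x).toReal - ε := by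
      have h1 : ε ≤ |Ψ x - (U x).toReal| := by simpa using Set.disjoint_left.1 hd hx
      have h2 : Ψ x ≤ (U x).toReal :=
        EReal.coe_le_coe_iff.1 ((hU.2.1 x).trans_eq (EReal.coe_toReal hx' (hUbot x)).symm)
      rw [abs_of_nonpos (by linarith)] at h1
      linarith
    -- A measurable set where `|Ψ - u| ≥ ε` is null: the majorant can be lowered by `ε` on it.
    have hlow := hU.2.2 (fun x => if x ∈ C ∧ U x ≠ ⊤ then (((U x).toReal - ε : ℝ) : EReal) else U x)
      (Measurable.ite (hC.inter (hU.1 (measurableSet_singleton ⊤)).compl)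
        (hum.sub_const ε).coe_real_ereal hU.1) fun x => by
        split_ifs with hx
        exacts [EReal.coe_le_coe_iff.2 (hC' hx.1 hx.2), hU.2.1 x]
    have : ∀ᵐ x ∂P₁, x ∉ C := by
      filter_upwards [hlow, hUtop, hUu] with x h1 h2 h3 hx
      rw [if_pos ⟨hx, h2⟩, h3, EReal.coe_le_coe_iff, EReal.toReal_coe] at h1
      linarith
    simpa [ae_iff] using this
  · filter_upwards [hg.ae_eq hU.comp_eval_zero,
      (measurePreserving_eval_infinitePi (fun _ : ℕ => P₁) 0).quasiMeasurePreserving.ae hUu]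
      with ω h1 h2
    exact h1.trans h2

/-! ### Maximal nonmeasurability -/

theorem theorem1 {Ω₁ : Type*} [MeasurableSpace Ω₁] (P₁ : Measure Ω₁) [IsProbabilityMeasure P₁]
    (Ψ : Ω₁ → ℝ)
    (hΨ : upperExpectation (Measure.infinitePi fun _ : ℕ => P₁) (fun ω => |iidVar Ψ 0 ω|) < ⊤)
    (A : Set ℝ) (hA : A.Nonempty)
    (hA' : A ⊂ {x : ℝ |
      lowerExpectation (Measure.infinitePi fun _ : ℕ => P₁) (iidVar Ψ 0) ≤ (x : EReal) ∧
      (x : EReal) ≤ upperExpectation (Measure.infinitePi fun _ : ℕ => P₁) (iidVar Ψ 0)}) :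
    MaximallyNonmeasurable (Measure.infinitePi fun _ : ℕ => P₁)
      {ω | ∃ a ∈ A, liminf (fun n => (iidMean Ψ ω n : EReal)) atTop = (a : EReal)} ∧
    MaximallyNonmeasurable (Measure.infinitePi fun _ : ℕ => P₁)
      {ω | ∃ a ∈ A, limsup (fun n => (iidMean Ψ ω n : EReal)) atTop = (a : EReal)} ∧
    MaximallyNonmeasurable (Measure.infinitePi fun _ : ℕ => P₁)
      {ω | ∃ a ∈ A, Tendsto (iidMean Ψ ω) atTop (𝓝 a)} ∧
    MaximallyNonmeasurable (Measure.infinitePi fun _ : ℕ => P₁)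
      {ω | ∃ l : ℝ, Tendsto (iidMean Ψ ω) atTop (𝓝 l)} ∧
    MaximallyNonmeasurable (Measure.infinitePi fun _ : ℕ => P₁)
      {ω | ∀ x : ℝ, MapClusterPt x atTop (iidMean Ψ ω) → x ∈ A} := by
  have hp := measurePreserving_eval_infinitePi (fun _ : ℕ => P₁) 0
  obtain ⟨u, hum, hui, hu, hU⟩ := exists_integrable_majorant hΨ
  -- Almost surely, `-l` is the maximal measurable minorant of `Ψ`.
  obtain ⟨l, hlm, hli, hl, hL⟩ := exists_integrable_majorant (P₁ := P₁) (Ψ := fun x => -Ψ x)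
    (by simpa only [abs_neg, iidVar] using hΨ)
  have hupper : upperExpectation (Measure.infinitePi fun _ : ℕ => P₁) (iidVar Ψ 0) =
      ((∫ x, u x ∂P₁ : ℝ) : EReal) := by
    have := extExpectation_eq_integral (hU _ (exists_isMinMeasurableMajorant _ _).choose_spec)
      (hp.integrable_comp_of_integrable hui)
    exact this.trans (congrArg _ (integral_eval_infinitePi P₁ hum 0))
  have hlower : lowerExpectation (Measure.infinitePi fun _ : ℕ => P₁) (iidVar Ψ 0) =
      ((∫ x, -l x ∂P₁ : ℝ) : EReal) := by
    have hae := hL _ (exists_isMaxMeasurableMinorant (Measure.infinitePi fun _ : ℕ => P₁)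
      (fun ω => (Ψ (ω 0) : EReal))).choose_spec.neg
    have := extExpectation_eq_integral (P := Measure.infinitePi fun _ : ℕ => P₁)
      (g := maxMeasurableMinorant (Measure.infinitePi fun _ : ℕ => P₁)
        (fun ω => (Ψ (ω 0) : EReal))) (v := fun ω => -l (ω 0))
      (hae.mono fun ω hω => neg_inj.1 (hω.trans (by simp)))
      (hp.integrable_comp_of_integrable hli.neg)
    exact this.trans (congrArg _ (integral_eval_infinitePi P₁ hlm.neg 0))
  rw [hupper, hlower] at hA'
  simp only [EReal.coe_le_coe_iff] at hA'
  obtain ⟨a, ha⟩ := hA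
  obtain ⟨b, hb, hbA⟩ := Set.exists_of_ssubset hA'
  have hl' : ∀ ε > 0, P₁ {x | |Ψ x - -l x| < ε} = 1 := fun ε hε => by
    simpa only [← neg_add', abs_neg, sub_neg_eq_add] using hl ε hε
  have hconv {c : ℝ} (hc : ∫ x, -l x ∂P₁ ≤ c ∧ c ≤ ∫ x, u x ∂P₁) :=
    measure_tendsto_iidMean_eq_one hlm.neg hum hli.neg hui hl' hu hc
  have hKa := hconv (hA'.1 ha)
  have hKb := hconv hb
  have hEReal {ω : ℕ → Ω₁} {c : ℝ} (h : Tendsto (iidMean Ψ ω) atTop (𝓝 c)) :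
      Tendsto (fun n => (iidMean Ψ ω n : EReal)) atTop (𝓝 (c : EReal)) :=
    (continuous_coe_real_ereal.tendsto c).comp h
  refine ⟨?_, ?_, ?_, ?_, ?_⟩
  · refine maximallyNonmeasurable_of_superset hKa (fun ω hω => ⟨a, ha, (hEReal hω).liminf_eq⟩)
      hKb (Set.disjoint_left.2 ?_)
    rintro ω hω ⟨c, hc, h⟩
    exact hbA (EReal.coe_injective ((hEReal hω).liminf_eq.symm.trans h) ▸ hc)
  · refine maximallyNonmeasurable_of_superset hKa (fun ω hω => ⟨a, ha, (hEReal hω).limsup_eq⟩)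
      hKb (Set.disjoint_left.2 ?_)
    rintro ω hω ⟨c, hc, h⟩
    exact hbA (EReal.coe_injective ((hEReal hω).limsup_eq.symm.trans h) ▸ hc)
  · refine maximallyNonmeasurable_of_superset hKa (fun ω hω => ⟨a, ha, hω⟩)
      hKb (Set.disjoint_left.2 ?_)
    rintro ω hω ⟨c, hc, h⟩
    exact hbA (tendsto_nhds_unique hω h ▸ hc)
  · have hne : ∫ x, -l x ∂P₁ ≠ ∫ x, u x ∂P₁ := fun h => by
      have h1 := hA'.1 ha
      obtain rfl : a = b := le_antisymm (by linarith [h1.2, hb.1]) (by linarith [h1.1, hb.2])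
      exact hbA ha
    exact maximallyNonmeasurable_of_superset hKa (fun ω hω => ⟨a, hω⟩)
      (measure_not_tendsto_iidMean_eq_one hlm.neg hum hli.neg hui hl' hu hne)
      (Set.disjoint_left.2 fun ω h1 h2 => h1 h2)
  · refine maximallyNonmeasurable_of_superset hKa (fun ω hω x hx => ?_)
      hKb (Set.disjoint_left.2 fun ω hω h => hbA (h b (Tendsto.mapClusterPt hω)))
    have hxa : x = a := eq_of_nhds_neBot (hx.clusterPt.mono hω)
    exact hxa ▸ ha
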